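/- Let $n\ge 0$ and let $$X=\{[1:z_1:\cdots:z_n]\in\mathbb{C}P^n \mid z_i\neq 0\ (1\le i\le n)\}\cong(\mathbb{C}^*)^n,$$ an open complex submanifold of $\mathbb{C}P^n$, equipped with the restriction of the Fubini--Study metric, normalized so that a projective line has area $1$. For a holomorphic map $f:\mathbb{C}\to X$ put $|df|(z):=\sqrt2\,|df(\partial/\partial z)|$, where $\partial/\partial z=\frac12(\partial/\partial x-\sqrt{-1}\,\partial/\partial y)$; thus, if $f=[1:f_1:\cdots:f_n]$, then $$|df|^2(z)=\frac1{4\pi}\left(\frac{\partial^2}{\partial x^2}+\frac{\partial^2}{\partial y^2}\right)\log\Bigl(1+\sum_{i=1}^n|f_i(z)|^2\Bigr).$$ Suppose that $f:\mathbb{C}\to X$ is a holomorphic map with bounded derivative, i.e. there is a constant $C>0$ such that $|df|(z)\le C$ for all $z\in\mathbb{C}$. Then there are complex numbers $a_i,b_i$ $(1\le i\le n)$ such that, for all $z\in\mathbb{C}$, $$f(z)=[\,1:e^{a_1z+b_1}:e^{a_2z+b_2}:\cdots:e^{a_nz+b_n}\,].$$ -/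

import Mathlib

open scoped Manifold ContDiff

/-- Complex projective space `ℂP^n`: the set of complex lines through the origin in `ℂ^{n+1}`. -/
def CPn (n : ℕ) : Type := Projectivization ℂ (Fin (n + 1) → ℂ)

namespace CPn

variable {n : ℕ}

/-- The point `[v_0 : ⋯ : v_n]` with homogeneous coordinates `v ≠ 0`. -/
noncomputable def mk (v : Fin (n + 1) → ℂ) (hv : v ≠ 0) : CPn n := Projectivization.mk ℂ v hv

/-- The quotient map `ℂ^{n+1} ∖ {0} → ℂP^n`. -/
noncomputable def proj (v : {v : Fin (n + 1) → ℂ // v ≠ 0}) : CPn n := mk v.1 v.2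

/-- `ℂP^n` carries the quotient topology of `ℂ^{n+1} ∖ {0}`. -/
noncomputable instance : TopologicalSpace (CPn n) := TopologicalSpace.coinduced proj inferInstance

theorem isQuotientMap_proj : Topology.IsQuotientMap (proj (n := n)) :=
  ⟨⟨rfl⟩, fun p => by
    induction p using Projectivization.ind with
    | h v hv => exact ⟨⟨v, hv⟩, rfl⟩⟩

/-- The condition that the `i`-th homogeneous coordinate does not vanish. -/
def CoordNe (i : Fin (n + 1)) (p : CPn n) : Prop :=
  Projectivization.lift (K := ℂ) (fun v : {v : Fin (n + 1) → ℂ // v ≠ 0} => v.1 i ≠ 0)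
    (by
      rintro ⟨a, ha⟩ ⟨b, hb⟩ t h
      have ht : t ≠ 0 := by rintro rfl; exact ha (by simpa using h)
      simp only at h
      simp [h, ht]) p

@[simp] theorem coordNe_mk (i : Fin (n + 1)) (v : Fin (n + 1) → ℂ) (hv : v ≠ 0) :
    CoordNe i (mk v hv) ↔ v i ≠ 0 := Iff.rfl

theorem exists_coordNe (p : CPn n) : ∃ i, CoordNe i p := by
  induction p using Projectivization.ind with
  | h v hv => exact Function.ne_iff.mp hv

theorem isOpen_coordNe (i : Fin (n + 1)) : IsOpen {p : CPn n | CoordNe i p} := by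
  rw [← isQuotientMap_proj.isOpen_preimage]
  exact isOpen_ne.preimage ((continuous_apply i).comp continuous_subtype_val)

/-- The affine coordinates `(v_j / v_i)_{j ≠ i}` of `[v]` (meaningful where `v_i ≠ 0`). -/
noncomputable def affineCoord (i : Fin (n + 1)) (p : CPn n) : EuclideanSpace ℂ (Fin n) :=
  Projectivization.lift (K := ℂ)
    (fun v : {v : Fin (n + 1) → ℂ // v ≠ 0} =>
      WithLp.toLp 2 fun j => v.1 (i.succAbove j) / v.1 i)
    (by
      rintro ⟨a, ha⟩ ⟨b, hb⟩ t h
      have ht : t ≠ 0 := by rintro rfl; exact ha (by simpa using h)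
      simp only at h
      simp only [h, Pi.smul_apply, smul_eq_mul, mul_div_mul_left _ _ ht]) p

@[simp] theorem affineCoord_mk (i : Fin (n + 1)) (v : Fin (n + 1) → ℂ) (hv : v ≠ 0) (j : Fin n) :
    affineCoord i (mk v hv) j = v (i.succAbove j) / v i := rfl

theorem insertNth_one_ne_zero (i : Fin (n + 1)) (ζ : Fin n → ℂ) :
    (i.insertNth (1 : ℂ) ζ : Fin (n + 1) → ℂ) ≠ 0 := fun h => by
  simpa using congrFun h i

/-- The point whose homogeneous coordinates are `1` in position `i` and `ζ` in the others;
for `i = 0` this is `[1 : ζ_1 : ⋯ : ζ_n]`. -/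
noncomputable def affinePt (i : Fin (n + 1)) (ζ : Fin n → ℂ) : CPn n :=
  mk (i.insertNth (1 : ℂ) ζ) (insertNth_one_ne_zero i ζ)

theorem affinePt_affineCoord (i : Fin (n + 1)) (p : CPn n) (hp : CoordNe i p) :
    affinePt i (affineCoord i p) = p := by
  induction p using Projectivization.ind with
  | h v hv =>
    have hvi : v i ≠ 0 := hp
    refine (Projectivization.mk_eq_mk_iff' ℂ _ _ _ _).2 ⟨(v i)⁻¹, ?_⟩
    funext k
    refine Fin.succAboveCases i ?_ (fun j => ?_) k
    · simp [hvi]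
    · rw [Fin.insertNth_apply_succAbove]
      change (v i)⁻¹ * v (i.succAbove j) = v (i.succAbove j) / v i
      rw [div_eq_inv_mul]

/-- The `i`-th standard affine chart of `ℂP^n`. -/
noncomputable def affineChart (i : Fin (n + 1)) :
    OpenPartialHomeomorph (CPn n) (EuclideanSpace ℂ (Fin n)) where
  toFun := affineCoord i
  invFun ζ := affinePt i ζ
  source := {p | CoordNe i p}
  target := Set.univ
  map_source' _ _ := Set.mem_univ _
  map_target' ζ _ := by
    change (i.insertNth (1 : ℂ) (ζ : Fin n → ℂ) : Fin (n + 1) → ℂ) i ≠ 0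
    simp
  left_inv' p hp := affinePt_affineCoord i p hp
  right_inv' ζ _ := by
    ext j
    simp [affinePt]
  open_source := isOpen_coordNe i
  open_target := isOpen_univ
  continuousOn_toFun := by
    refine (isQuotientMap_proj.continuousOn_isOpen_iff (isOpen_coordNe i)).2 ?_
    refine (PiLp.continuous_toLp 2 _).comp_continuousOn
      (continuousOn_pi.2 fun j => ContinuousOn.div ?_ ?_ fun v hv => hv)
    · exact ((continuous_apply _).comp continuous_subtype_val).continuousOn
    · exact ((continuous_apply _).comp continuous_subtype_val).continuousOn
  continuousOn_invFun := by
    have h : Continuous fun ζ : EuclideanSpace ℂ (Fin n) =>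
        (⟨i.insertNth (1 : ℂ) ζ.ofLp, insertNth_one_ne_zero i _⟩ :
          {v : Fin (n + 1) → ℂ // v ≠ 0}) := by
      refine Continuous.subtype_mk (continuous_pi fun k => ?_) _
      refine Fin.succAboveCases i ?_ (fun j => ?_) k
      · simpa using continuous_const
      · simp only [Fin.insertNth_apply_succAbove]
        fun_prop
    exact (isQuotientMap_proj.continuous.comp h).continuousOn

open scoped Classical in
/-- The atlas of `ℂP^n` consists of the standard affine charts; the preferred chart at a point
belongs to its first nonvanishing homogeneous coordinate. -/
noncomputable instance : ChartedSpace (EuclideanSpace ℂ (Fin n)) (CPn n) where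
  atlas := Set.range affineChart
  chartAt p := affineChart (Fin.find (fun i => CoordNe i p) (exists_coordNe p))
  mem_chart_source p := Fin.find_spec (exists_coordNe p)
  chart_mem_atlas _ := ⟨_, rfl⟩

/-- `ℂP^n` is a complex (analytic) manifold of dimension `n`. -/
instance : IsManifold 𝓘(ℂ, EuclideanSpace ℂ (Fin n)) ω (CPn n) := by
  refine isManifold_of_contDiffOn _ _ _ ?_
  rintro _ _ ⟨i, rfl⟩ ⟨k, rfl⟩
  have hc : ∀ l : Fin (n + 1), ContDiff ℂ ω
      (fun ζ : EuclideanSpace ℂ (Fin n) => (i.insertNth (1 : ℂ) ζ.ofLp : Fin (n + 1) → ℂ) l) := by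
    intro l
    refine Fin.succAboveCases i ?_ (fun j => ?_) l
    · simpa using contDiff_const
    · simp only [Fin.insertNth_apply_succAbove]
      fun_prop
  refine contDiffOn_euclidean.2 fun j => ?_
  refine ContDiffOn.div (hc (k.succAbove j)).contDiffOn (hc k).contDiffOn ?_
  intro ζ hζ
  have h := hζ.1.2
  exact h

/-- The Fubini–Study length of a holomorphic tangent vector `u` at `p`. In the affine chart
preferred at `p`, with coordinates `ζ`, the Fubini–Study metric is the Hermitian form
with matrix `(2π)⁻¹ ∂²/∂ζ_j∂ζ̄_k log (1 + |ζ|²)`, that is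
`|u|² = ((1 + |ζ|²) |u|² - |⟨ζ, u⟩|²) / (2π (1 + |ζ|²)²)`.
The normalization is the one for which a projective line has area `1` and for which, as for
the flat metric on `ℂ`, the length of `∂/∂z = (∂/∂x - √-1 ∂/∂y) / 2` is `1/√2` times
the length of the real tangent vector `∂/∂x`. -/
noncomputable def fubiniStudyNorm (p : CPn n)
    (u : TangentSpace 𝓘(ℂ, EuclideanSpace ℂ (Fin n)) p) : ℝ :=
  let ζ : EuclideanSpace ℂ (Fin n) := chartAt (EuclideanSpace ℂ (Fin n)) p p
  let w : EuclideanSpace ℂ (Fin n) := u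
  Real.sqrt (((1 + ‖ζ‖ ^ 2) * ‖w‖ ^ 2 - ‖inner ℂ ζ w‖ ^ 2) /
    (2 * Real.pi * (1 + ‖ζ‖ ^ 2) ^ 2))

end CPn

/-- The complex manifold `X = {[1 : z_1 : ⋯ : z_n] | z_i ≠ 0} ≅ (ℂ^*)^n`, an open submanifold
of `ℂP^n`. -/
def torusX (n : ℕ) : TopologicalSpace.Opens (CPn n) where
  carrier := {p | ∃ ζ : Fin n → ℂ, (∀ i, ζ i ≠ 0) ∧ p = CPn.affinePt 0 ζ}
  is_open' := by
    have h : {p : CPn n | ∃ ζ : Fin n → ℂ, (∀ i, ζ i ≠ 0) ∧ p = CPn.affinePt 0 ζ} =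
        ⋂ i, {p | CPn.CoordNe i p} := by
      ext p
      simp only [Set.mem_ofPred_eq, Set.mem_iInter]
      constructor
      · rintro ⟨ζ, hζ, rfl⟩ i
        rw [CPn.affinePt, CPn.coordNe_mk]
        refine Fin.cases ?_ (fun j => ?_) i
        · simp
        · simpa using hζ j
      · intro hp
        refine ⟨CPn.affineCoord 0 p, fun j => ?_, (CPn.affinePt_affineCoord 0 p (hp 0)).symm⟩
        induction p using Projectivization.ind with
        | h v hv =>
          exact div_ne_zero (show v ((0 : Fin (n + 1)).succAbove j) ≠ 0 from hp _)
            (show v 0 ≠ 0 from hp 0)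
    rw [h]
    exact isOpen_iInter_of_finite CPn.isOpen_coordNe

/-- `|df|(z) = √2 |df(∂/∂z)|`, where `X` carries the restriction of the Fubini–Study metric.
The image `df(∂/∂z)` is the complex derivative of `f`, seen as a map to `ℂP^n`, applied to `1`. -/
noncomputable def normDf {n : ℕ} (f : ℂ → torusX n) (z : ℂ) : ℝ :=
  Real.sqrt 2 * CPn.fubiniStudyNorm (f z : CPn n)
    (mfderiv 𝓘(ℂ, ℂ) 𝓘(ℂ, EuclideanSpace ℂ (Fin n)) (fun w => (f w : CPn n)) z (1 : ℂ))

/-! Write the homogeneous coordinates of `f` as `e^{g_k}` with `g_0 = 0` and `g_k` entire. The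
potential `φ = log (∑ |e^{g_k}|²) / 2` has Laplacian `2 * fsDensity`, and `fsDensity = π |df|²` is
bounded. Integrating over circles shows that the means of `φ` are `O(R²)`
(`circleAverage_fsPotential_le`). Since `φ ≥ 0` and `Re g_k ≤ φ`, the Poisson formula,
Borel–Carathéodory and Cauchy estimates make each `g_k` a polynomial of degree at most 2
(`Differentiable.eq_quadratic_of_circleAverage_le`). It remains to exclude quadratic terms
(`quadratic_coeff_eq_zero`). If some existed, different leading coefficients would dominate in
different directions of a large circle. By connectedness, two exponents with different leading
coefficients are both maximal at some point of it. There the density is at least a constant times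
`|g_i' - g_l'|²` (`norm_deriv_sub_sq_le_fsDensity`), which grows like `R²`: a contradiction. -/

open MeasureTheory in
theorem hasDerivAt_intervalIntegral_of_continuous {F F' : ℝ → ℝ → ℝ}
    (hF : Continuous (Function.uncurry F)) (hF' : Continuous (Function.uncurry F'))
    (h : ∀ t x, HasDerivAt (fun s => F s x) (F' t x) t) (a b t : ℝ) :
    HasDerivAt (fun s => ∫ x in a..b, F s x) (∫ x in a..b, F' t x) t := by
  obtain ⟨B, hB⟩ := ((isCompact_closedBall t 1).prod (isCompact_uIcc (a := a) (b := b)))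
    |>.exists_bound_of_continuousOn hF'.continuousOn
  have hFc : ∀ s, Continuous (F s) := fun s => hF.comp (Continuous.prodMk_right s)
  have hFc' : ∀ s, Continuous (F' s) := fun s => hF'.comp (Continuous.prodMk_right s)
  refine (intervalIntegral.hasDerivAt_integral_of_dominated_loc_of_deriv_le
    (F' := F') (bound := fun _ => B) (Metric.closedBall_mem_nhds t one_pos)
    (Filter.Eventually.of_forall fun s => (hFc s).aestronglyMeasurable)
    ((hFc t).intervalIntegrable _ _) (hFc' t).aestronglyMeasurable
    (Filter.Eventually.of_forall fun x hx s hs => hB (s, x) ⟨hs, Set.uIoc_subset_uIcc hx⟩)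
    intervalIntegrable_const (Filter.Eventually.of_forall fun x _ s _ => h s x)).2

/-! ### The Fubini–Study potential and its circle averages. -/

section LogSumExp

variable {ι : Type*} [Fintype ι]

/-- The sum of the squared moduli `∑ |e^{g_k}|²`. -/
noncomputable def expSum (g : ι → ℂ → ℂ) (z : ℂ) : ℝ := ∑ k, Real.exp (2 * (g k z).re)

/-- The potential `log (∑ |e^{g_k}|²) / 2` of the Fubini–Study form along `[e^{g_k}]_k`. -/
noncomputable def fsPotential (g : ι → ℂ → ℂ) (z : ℂ) : ℝ := Real.log (expSum g z) / 2

/-- The Fubini–Study density of the curve `[e^{g_k}]_k`, up to a constant factor. -/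
noncomputable def fsDensity (g : ι → ℂ → ℂ) (z : ℂ) : ℝ :=
  (expSum g z * ∑ k, Real.exp (2 * (g k z).re) * ‖deriv (g k) z‖ ^ 2 -
    ‖∑ k, (Real.exp (2 * (g k z).re) : ℂ) * deriv (g k) z‖ ^ 2) / expSum g z ^ 2

theorem expSum_pos [Nonempty ι] (g : ι → ℂ → ℂ) (z : ℂ) : 0 < expSum g z :=
  Finset.sum_pos (fun _ _ => Real.exp_pos _) Finset.univ_nonempty

theorem exp_le_expSum (g : ι → ℂ → ℂ) (k : ι) (z : ℂ) :
    Real.exp (2 * (g k z).re) ≤ expSum g z :=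
  Finset.single_le_sum (f := fun k => Real.exp (2 * (g k z).re))
    (fun _ _ => (Real.exp_pos _).le) (Finset.mem_univ k)

theorem re_le_fsPotential (g : ι → ℂ → ℂ) (k : ι) (z : ℂ) : (g k z).re ≤ fsPotential g z := by
  have := Real.log_le_log (Real.exp_pos _) (exp_le_expSum g k z)
  rw [Real.log_exp] at this
  rw [fsPotential]
  linarith

theorem continuous_expSum {g : ι → ℂ → ℂ} (hg : ∀ k, Continuous (g k)) :
    Continuous (expSum g) := by
  unfold expSum
  fun_prop

theorem continuous_fsPotential [Nonempty ι] {g : ι → ℂ → ℂ} (hg : ∀ k, Continuous (g k)) :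
    Continuous (fsPotential g) :=
  ((continuous_expSum hg).log fun z => (expSum_pos g z).ne').div_const _

/-- The derivative of the potential in the direction `v`. -/
noncomputable def fsPotentialDeriv (g : ι → ℂ → ℂ) (v z : ℂ) : ℝ :=
  (∑ k, Real.exp (2 * (g k z).re) * (v * deriv (g k) z).re) / expSum g z

/-- The second derivative of the potential in the direction `v`. -/
noncomputable def fsPotentialDeriv₂ (g : ι → ℂ → ℂ) (v z : ℂ) : ℝ :=
  ((∑ k, Real.exp (2 * (g k z).re) * (2 * (v * deriv (g k) z).re ^ 2 +
    (v ^ 2 * deriv (deriv (g k)) z).re)) * expSum g z -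
    2 * (∑ k, Real.exp (2 * (g k z).re) * (v * deriv (g k) z).re) ^ 2) / expSum g z ^ 2

theorem continuous_fsPotentialDeriv [Nonempty ι] {g : ι → ℂ → ℂ}
    (hg : ∀ k, Differentiable ℂ (g k)) (v : ℂ) : Continuous (fsPotentialDeriv g v) := by
  have h0 := fun k => (hg k).continuous
  have h1 := fun k => (hg k).deriv.continuous
  refine Continuous.div ?_ (continuous_expSum h0) fun z => (expSum_pos g z).ne'
  fun_prop

theorem continuous_fsPotentialDeriv₂ [Nonempty ι] {g : ι → ℂ → ℂ}
    (hg : ∀ k, Differentiable ℂ (g k)) (v : ℂ) : Continuous (fsPotentialDeriv₂ g v) := by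
  have h0 := fun k => (hg k).continuous
  have h1 := fun k => (hg k).deriv.continuous
  have h2 := fun k => (hg k).deriv.deriv.continuous
  have h3 := continuous_expSum h0
  refine Continuous.div ?_ (h3.pow 2) fun z => pow_ne_zero 2 (expSum_pos g z).ne'
  fun_prop

theorem hasDerivAt_re_mul_comp {h : ℂ → ℂ} (hh : Differentiable ℂ h) {γ : ℝ → ℂ} {v : ℂ} {t : ℝ}
    (hγ : HasDerivAt γ v t) (c : ℂ) :
    HasDerivAt (fun s => (c * h (γ s)).re) (c * (v * deriv h (γ t))).re t := by
  have h1 : HasDerivAt (fun s => h (γ s)) (deriv h (γ t) * v) t :=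
    (hh (γ t)).hasDerivAt.comp t hγ
  have h2 := Complex.reCLM.hasFDerivAt.comp_hasDerivAt t (h1.const_mul c)
  simpa [mul_comm v] using! h2

theorem hasDerivAt_exp_re {h : ℂ → ℂ} (hh : Differentiable ℂ h) {γ : ℝ → ℂ} {v : ℂ} {t : ℝ}
    (hγ : HasDerivAt γ v t) :
    HasDerivAt (fun s => Real.exp (2 * (h (γ s)).re))
      (2 * (Real.exp (2 * (h (γ t)).re) * (v * deriv h (γ t)).re)) t := by
  have := ((hasDerivAt_re_mul_comp hh hγ 1).const_mul 2).exp
  simp only [one_mul] at this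
  convert this using 1
  ring

theorem hasDerivAt_expSum {g : ι → ℂ → ℂ} (hg : ∀ k, Differentiable ℂ (g k)) {γ : ℝ → ℂ} {v : ℂ}
    {t : ℝ} (hγ : HasDerivAt γ v t) :
    HasDerivAt (fun s => expSum g (γ s))
      (2 * ∑ k, Real.exp (2 * (g k (γ t)).re) * (v * deriv (g k) (γ t)).re) t := by
  rw [Finset.mul_sum]
  exact HasDerivAt.fun_sum fun k _ => hasDerivAt_exp_re (hg k) hγ

theorem hasDerivAt_fsPotential [Nonempty ι] {g : ι → ℂ → ℂ} (hg : ∀ k, Differentiable ℂ (g k))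
    {γ : ℝ → ℂ} {v : ℂ} {t : ℝ} (hγ : HasDerivAt γ v t) :
    HasDerivAt (fun s => fsPotential g (γ s)) (fsPotentialDeriv g v (γ t)) t := by
  refine (((hasDerivAt_expSum hg hγ).log (expSum_pos g _).ne').div_const 2).congr_deriv ?_
  rw [fsPotentialDeriv]
  ring

theorem hasDerivAt_fsPotentialDeriv [Nonempty ι] {g : ι → ℂ → ℂ}
    (hg : ∀ k, Differentiable ℂ (g k)) {γ : ℝ → ℂ} {v : ℂ} {t : ℝ} (hγ : HasDerivAt γ v t) :
    HasDerivAt (fun s => fsPotentialDeriv g v (γ s)) (fsPotentialDeriv₂ g v (γ t)) t := by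
  have h1 := HasDerivAt.fun_sum (u := Finset.univ) fun k _ => (hasDerivAt_exp_re (hg k) hγ).fun_mul
    (hasDerivAt_re_mul_comp (hg k).deriv hγ v)
  refine (h1.fun_div (hasDerivAt_expSum hg hγ) (expSum_pos g _).ne').congr_deriv ?_
  have h2 : ∑ k, Real.exp (2 * (g k (γ t)).re) * (2 * (v * deriv (g k) (γ t)).re ^ 2 +
      (v ^ 2 * deriv (deriv (g k)) (γ t)).re) =
      ∑ k, (2 * (Real.exp (2 * (g k (γ t)).re) * (v * deriv (g k) (γ t)).re) *
        (v * deriv (g k) (γ t)).re + Real.exp (2 * (g k (γ t)).re) *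
        (v * (v * deriv (deriv (g k)) (γ t))).re) :=
    Finset.sum_congr rfl fun k _ => by
      rw [← mul_assoc v v, ← sq v]
      ring
  rw [fsPotentialDeriv₂, h2]
  ring

/-- The left side is the Laplacian of the potential. The terms in `g_k''` cancel because `1² + I² =
0`, that is, because `Re g_k` is harmonic. -/
theorem fsPotentialDeriv₂_add (g : ι → ℂ → ℂ) (z : ℂ) :
    fsPotentialDeriv₂ g 1 z + fsPotentialDeriv₂ g Complex.I z = 2 * fsDensity g z := by
  have key : ‖∑ k, (Real.exp (2 * (g k z).re) : ℂ) * deriv (g k) z‖ ^ 2 =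
      (∑ k, Real.exp (2 * (g k z).re) * (deriv (g k) z).re) ^ 2 +
      (∑ k, Real.exp (2 * (g k z).re) * (deriv (g k) z).im) ^ 2 := by
    rw [← Complex.normSq_eq_norm_sq, Complex.normSq_apply, Complex.re_sum, Complex.im_sum]
    simp only [Complex.re_ofReal_mul, Complex.im_ofReal_mul]
    ring
  have key2 : ∑ k, Real.exp (2 * (g k z).re) * ‖deriv (g k) z‖ ^ 2 =
      ∑ k, Real.exp (2 * (g k z).re) * (deriv (g k) z).re ^ 2 +
      ∑ k, Real.exp (2 * (g k z).re) * (deriv (g k) z).im ^ 2 := by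
    rw [← Finset.sum_add_distrib]
    refine Finset.sum_congr rfl fun k _ => ?_
    rw [← Complex.normSq_eq_norm_sq, Complex.normSq_apply]
    ring
  rw [fsPotentialDeriv₂, fsPotentialDeriv₂, fsDensity, key, key2, ← add_div, ← mul_div_assoc]
  congr 1
  simp only [one_mul, one_pow, Complex.I_sq, Complex.I_mul_re, mul_add, Finset.sum_add_distrib,
    neg_mul, mul_neg, Finset.sum_neg_distrib, Complex.neg_re, neg_sq,
    mul_left_comm _ (2 : ℝ), ← Finset.mul_sum]
  ring

/-- The factor is `|e^w|²`, from the chain rule. It allows logarithmic coordinates, in which circles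
about `0` become vertical segments. -/
theorem fsDensity_comp_exp {g : ι → ℂ → ℂ} (hg : ∀ k, Differentiable ℂ (g k)) (w : ℂ) :
    fsDensity (fun k w => g k (Complex.exp w)) w =
      Real.exp (2 * w.re) * fsDensity g (Complex.exp w) := by
  have hd : ∀ k, deriv (fun w => g k (Complex.exp w)) w =
      Complex.exp w * deriv (g k) (Complex.exp w) := fun k => by
    rw [mul_comm]
    exact ((hg k _).hasDerivAt.comp w (Complex.hasDerivAt_exp w)).deriv
  have he : Real.exp (2 * w.re) = ‖Complex.exp w‖ ^ 2 := by
    rw [Complex.norm_exp, ← Real.exp_nat_mul, Nat.cast_ofNat]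
  simp only [fsDensity, hd, norm_mul, mul_pow, expSum, mul_left_comm _ (Complex.exp w),
    mul_left_comm _ (‖Complex.exp w‖ ^ 2), ← Finset.mul_sum, he]
  ring

/-- If the Fubini–Study density is bounded, then the circle averages of the potential grow at most
quadratically. -/
theorem circleAverage_fsPotential_le [Nonempty ι] {g : ι → ℂ → ℂ}
    (hg : ∀ k, Differentiable ℂ (g k)) {K : ℝ} (hK : ∀ z, fsDensity g z ≤ K) :
    ∃ A : ℝ, 0 < A ∧ ∀ R : ℝ, 1 ≤ R → Real.circleAverage (fsPotential g) 0 R ≤ A * R ^ 2 := by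
  wlog hK0 : 0 ≤ K generalizing K
  · exact this (K := 0) (fun z => (hK z).trans (not_le.1 hK0).le) le_rfl
  set h : ι → ℂ → ℂ := fun k w => g k (Complex.exp w) with hh
  have hd : ∀ k, Differentiable ℂ (h k) := fun k => (hg k).comp Complex.differentiable_exp
  have hp : ∀ k w, deriv (h k) (w + 2 * Real.pi * Complex.I) = deriv (h k) w := fun k w => by
    rw [← deriv_comp_add_const]
    simp [hh, Complex.exp_add]
  let P : ℝ → ℝ → ℂ := fun t θ => t + θ * Complex.I
  have hPc : Continuous (Function.uncurry P) := by
    simp only [P, Function.uncurry_def]; fun_prop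
  have hP1 : ∀ t θ, HasDerivAt (fun s => P s θ) 1 t := fun t θ => by
    simpa [P] using! (Complex.ofRealCLM.hasDerivAt (x := t)).add_const (θ * Complex.I)
  have hP2 : ∀ t θ, HasDerivAt (fun s => P t s) Complex.I θ := fun t θ => by
    simpa [P] using!
      ((Complex.ofRealCLM.hasDerivAt (x := θ)).mul_const Complex.I).const_add (t : ℂ)
  -- `M t` is `2π` times the mean of the potential over the circle of radius `e^t`, and `N = M'`.
  let M : ℝ → ℝ := fun t => ∫ θ in (0 : ℝ)..2 * Real.pi, fsPotential h (P t θ)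
  let N : ℝ → ℝ := fun t => ∫ θ in (0 : ℝ)..2 * Real.pi, fsPotentialDeriv h 1 (P t θ)
  have hM : ∀ t, HasDerivAt M (N t) t := fun t =>
    hasDerivAt_intervalIntegral_of_continuous
      (F := fun t θ => fsPotential h (P t θ)) (F' := fun t θ => fsPotentialDeriv h 1 (P t θ))
      ((continuous_fsPotential fun k => (hd k).continuous).comp hPc)
      ((continuous_fsPotentialDeriv hd 1).comp hPc)
      (fun t θ => hasDerivAt_fsPotential hd (hP1 t θ)) _ _ t
  have hN : ∀ t, HasDerivAt N
      (∫ θ in (0 : ℝ)..2 * Real.pi, fsPotentialDeriv₂ h 1 (P t θ)) t := fun t =>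
    hasDerivAt_intervalIntegral_of_continuous
      (F := fun t θ => fsPotentialDeriv h 1 (P t θ))
      (F' := fun t θ => fsPotentialDeriv₂ h 1 (P t θ))
      ((continuous_fsPotentialDeriv hd 1).comp hPc)
      ((continuous_fsPotentialDeriv₂ hd 1).comp hPc)
      (fun t θ => hasDerivAt_fsPotentialDeriv hd (hP1 t θ)) _ _ t
  have hPt : ∀ t, Continuous (P t) := fun t => hPc.comp (Continuous.prodMk_right t)
  have hint : ∀ v t, IntervalIntegrable (fun θ => fsPotentialDeriv₂ h v (P t θ))
      MeasureTheory.volume 0 (2 * Real.pi) := fun v t =>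
    ((continuous_fsPotentialDeriv₂ hd v).comp (hPt t)).intervalIntegrable _ _
  -- The integrand is the `θ`-derivative of a `2π`-periodic function. Adding this zero turns `M''`
  -- into the integral of the full Laplacian.
  have hθ : ∀ t, ∫ θ in (0 : ℝ)..2 * Real.pi, fsPotentialDeriv₂ h Complex.I (P t θ) = 0 := by
    intro t
    rw [intervalIntegral.integral_eq_sub_of_hasDerivAt
      (f := fun θ => fsPotentialDeriv h Complex.I (P t θ))
      (fun θ _ => hasDerivAt_fsPotentialDeriv hd (hP2 t θ)) (hint _ t), sub_eq_zero]
    have e1 : P t (2 * Real.pi) = P t 0 + 2 * Real.pi * Complex.I := by simp [P]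
    have e2 : ∀ k, h k (P t 0 + 2 * Real.pi * Complex.I) = h k (P t 0) := fun k => by
      simp [hh, Complex.exp_add]
    simp only [e1, fsPotentialDeriv, expSum, hp, e2]
  have hN' : ∀ t, (∫ θ in (0 : ℝ)..2 * Real.pi, fsPotentialDeriv₂ h 1 (P t θ)) ≤
      4 * Real.pi * K * Real.exp (2 * t) := by
    intro t
    have hsum := intervalIntegral.integral_add (hint 1 t) (hint Complex.I t)
    rw [hθ t, add_zero] at hsum
    rw [← hsum]
    refine (intervalIntegral.integral_mono_on (g := fun _ => 2 * (Real.exp (2 * t) * K))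
      Real.two_pi_pos.le ((hint _ t).add (hint _ t)) intervalIntegrable_const
      fun θ _ => ?_).trans_eq ?_
    · rw [fsPotentialDeriv₂_add, hh, fsDensity_comp_exp hg]
      have : (P t θ).re = t := by simp [P]
      rw [this]
      gcongr
      exact hK _
    · rw [intervalIntegral.integral_const, smul_eq_mul]
      ring
  have hexp : ∀ t, HasDerivAt (fun t : ℝ => Real.exp (2 * t)) (2 * Real.exp (2 * t)) t := by
    intro t
    simpa [mul_comm] using ((hasDerivAt_id t).const_mul (2 : ℝ)).exp
  -- The inequality `M'' ≤ 4πK e^{2t}` is integrated twice from `0`, here and in `hMle`.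
  have hNle : ∀ t, 0 ≤ t → N t ≤ |N 0| + 2 * Real.pi * K * Real.exp (2 * t) := by
    intro t ht
    have hanti : Antitone fun t => N t - 2 * Real.pi * K * Real.exp (2 * t) :=
      antitone_of_hasDerivAt_nonpos (fun t => (hN t).sub ((hexp t).const_mul _)) fun t => by
        simp only [Pi.zero_apply]
        linarith [hN' t]
    have h1 := hanti ht
    have h2 : 0 ≤ 2 * Real.pi * K := by positivity
    simp only [mul_zero, Real.exp_zero] at h1
    linarith [le_abs_self (N 0)]
  have hMle : ∀ t, 0 ≤ t → M t ≤ |M 0| + |N 0| * t + Real.pi * K * Real.exp (2 * t) := by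
    intro t ht
    have hanti : AntitoneOn (fun t => M t - |N 0| * t - Real.pi * K * Real.exp (2 * t))
        (Set.Ici 0) := by
      have hder : ∀ t, HasDerivAt (fun t => M t - |N 0| * t - Real.pi * K * Real.exp (2 * t))
          (N t - |N 0| * 1 - Real.pi * K * (2 * Real.exp (2 * t))) t := fun t =>
        ((hM t).sub ((hasDerivAt_id t).const_mul _)).sub ((hexp t).const_mul _)
      refine antitoneOn_of_deriv_nonpos (convex_Ici 0)
        (fun t _ => (hder t).continuousAt.continuousWithinAt)
        (fun t _ => (hder t).differentiableAt.differentiableWithinAt) fun t ht => ?_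
      rw [interior_Ici] at ht
      rw [(hder t).deriv]
      linarith [hNle t (le_of_lt ht)]
    have h1 := hanti (Set.mem_Ici.2 le_rfl) (Set.mem_Ici.2 ht) ht
    have h2 : 0 ≤ Real.pi * K := by positivity
    simp only [mul_zero, Real.exp_zero] at h1
    linarith [le_abs_self (M 0)]
  -- With `t = log R`, both `1` and `log R` are at most `R²`, so the coefficients add up; the final
  -- `1` makes the constant positive.
  refine ⟨|M 0| + |N 0| + Real.pi * K + 1, by positivity, fun R hR => ?_⟩
  have hR0 : 0 < R := one_pos.trans_le hR
  have ht : 0 ≤ Real.log R := Real.log_nonneg hR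
  have heR : Real.exp (2 * Real.log R) = R ^ 2 := by
    rw [two_mul, Real.exp_add, Real.exp_log hR0, sq]
  have havg : Real.circleAverage (fsPotential g) 0 R = (2 * Real.pi)⁻¹ * M (Real.log R) := by
    rw [Real.circleAverage_def, smul_eq_mul]
    congr 1
    refine intervalIntegral.integral_congr fun θ _ => ?_
    have : circleMap 0 R θ = Complex.exp (P (Real.log R) θ) := by
      simp only [circleMap, P, Complex.exp_add, ← Complex.ofReal_exp, Real.exp_log hR0, zero_add]
    simp only [this, fsPotential, expSum, hh]
  have hlog : Real.log R ≤ R ^ 2 := by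
    nlinarith [Real.log_le_sub_one_of_pos hR0]
  have hR2 : 1 ≤ R ^ 2 := one_le_pow₀ hR
  have hMR := hMle _ ht
  rw [heR] at hMR
  have h3 : M (Real.log R) ≤ (|M 0| + |N 0| + Real.pi * K + 1) * R ^ 2 := by
    nlinarith [abs_nonneg (M 0), abs_nonneg (N 0),
      mul_le_mul_of_nonneg_left hlog (abs_nonneg (N 0))]
  have hpi : (2 * Real.pi)⁻¹ ≤ 1 := inv_le_one_of_one_le₀ (by linarith [Real.pi_gt_three])
  rw [havg]
  calc (2 * Real.pi)⁻¹ * M (Real.log R)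
      ≤ (2 * Real.pi)⁻¹ * ((|M 0| + |N 0| + Real.pi * K + 1) * R ^ 2) := by gcongr
    _ ≤ 1 * ((|M 0| + |N 0| + Real.pi * K + 1) * R ^ 2) := by gcongr
    _ = _ := one_mul _

end LogSumExp

/-! ### From circle averages to quadratic polynomials. -/

/-- If the real part of an entire function is dominated by a nonnegative function whose circle
averages grow at most quadratically, then the function is a quadratic polynomial. -/
theorem Differentiable.eq_quadratic_of_circleAverage_le {g : ℂ → ℂ} (hg : Differentiable ℂ g)
    {φ : ℂ → ℝ} (hφ : Continuous φ) (hφ0 : ∀ z, 0 ≤ φ z) (hgφ : ∀ z, (g z).re ≤ φ z) {A : ℝ}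
    (hA : 0 < A) (havg : ∀ R : ℝ, 1 ≤ R → Real.circleAverage φ 0 R ≤ A * R ^ 2) :
    ∃ c b a : ℂ, ∀ z, g z = c * z ^ 2 + b * z + a := by
  have hre : ∀ R : ℝ, 1 ≤ R → ∀ w ∈ Metric.ball (0 : ℂ) (R / 2),
      (g w).re ≤ 3 * (A * R ^ 2) := by
    intro R hR w hw
    have hR0 : 0 < R := one_pos.trans_le hR
    rw [mem_ball_zero_iff] at hw
    have hsub : ∀ z ∈ Metric.sphere (0 : ℂ) R, R / 2 < ‖z - w‖ := fun z hz => by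
      rw [mem_sphere_zero_iff_norm] at hz
      linarith [norm_sub_norm_le z w]
    let κ : ℂ → ℝ := fun z => (‖z‖ ^ 2 - ‖w‖ ^ 2) / ‖z - w‖ ^ 2
    have hκ0 : ∀ z ∈ Metric.sphere (0 : ℂ) R, 0 ≤ κ z := fun z hz => by
      rw [mem_sphere_zero_iff_norm] at hz
      refine div_nonneg (sub_nonneg.2 ?_) (sq_nonneg _)
      gcongr
      linarith
    -- The Poisson kernel is at most `(R + |w|) / (R - |w|)`, which is at most `3` for `|w| ≤ R /
    -- 2`.
    have hκ3 : ∀ z ∈ Metric.sphere (0 : ℂ) R, κ z ≤ 3 := fun z hz => by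
      have h1 := hsub z hz
      rw [mem_sphere_zero_iff_norm] at hz
      have h2 := norm_sub_norm_le z w
      rw [div_le_iff₀ (pow_pos (by linarith) 2)]
      rw [hz] at h2 ⊢
      nlinarith [norm_nonneg w]
    have hκc : ContinuousOn κ (Metric.sphere (0 : ℂ) |R|) := by
      refine ContinuousOn.div (by fun_prop) (by fun_prop) fun z hz => ?_
      rw [abs_of_pos hR0] at hz
      have := hsub z hz
      exact pow_ne_zero 2 (by linarith : (0 : ℝ) < _).ne'
    have hP := DiffContOnCl.circleAverage_poissonKernel_smul' (c := 0) (R := R) (w := w)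
      hg.diffContOnCl (by rw [mem_ball_zero_iff]; linarith)
    simp only [sub_zero] at hP
    have hint : ∀ {ψ : ℂ → ℝ}, Continuous ψ → CircleIntegrable (fun z => κ z * ψ z) 0 R :=
      fun hψ => (hκc.mul hψ.continuousOn).circleIntegrable'
    have hgi : CircleIntegrable (fun z => κ z • g z) 0 R :=
      (hκc.smul hg.continuous.continuousOn).circleIntegrable'
    have hP' : Real.circleAverage (fun z => κ z * (g z).re) 0 R = (g w).re := by
      rw [← hP]
      have := Complex.reCLM.circleAverage_comp_comm hgi
      have hκ : ∀ z, ((‖z‖ ^ 2 - ‖w‖ ^ 2) / ‖z - w‖ ^ 2 : ℝ) = κ z := fun _ => rfl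
      simp only [hκ]
      simpa [Function.comp_def] using! this
    rw [← hP']
    have h3 : Real.circleAverage (fun z => 3 * φ z) 0 R = 3 * Real.circleAverage φ 0 R := by
      simpa using! Real.circleAverage_fun_smul (a := (3 : ℝ)) (f := φ) (c := 0) (R := R)
    calc Real.circleAverage (fun z => κ z * (g z).re) 0 R
        ≤ Real.circleAverage (fun z => 3 * φ z) 0 R := by
          refine Real.circleAverage_mono (hint (Complex.continuous_re.comp hg.continuous))
            (hφ.const_mul 3).continuousOn.circleIntegrable' fun z hz => ?_
          rw [abs_of_pos hR0] at hz
          exact (mul_le_mul_of_nonneg_left (hgφ z) (hκ0 z hz)).trans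
            (mul_le_mul_of_nonneg_right (hκ3 z hz) (hφ0 z))
      _ ≤ 3 * (A * R ^ 2) := by
          rw [h3]
          gcongr
          exact havg R hR
  have hnorm : ∀ R : ℝ, 1 ≤ R → ∀ z ∈ Metric.sphere (0 : ℂ) (R / 4),
      ‖g z‖ ≤ (6 * A + 3 * ‖g 0‖) * R ^ 2 := by
    intro R hR z hz
    have hR0 : 0 < R := one_pos.trans_le hR
    rw [mem_sphere_zero_iff_norm] at hz
    -- Borel–Carathéodory passes from `Re g` on the disc of radius `R / 2` to `|g|` on the circle of
    -- radius `R / 4`.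
    have := Complex.borelCaratheodory (M := 3 * (A * R ^ 2)) (R := R / 2) (by positivity)
      hg.differentiableOn (hre R hR) (by positivity) (z := z)
      (by rw [mem_ball_zero_iff, hz]; linarith)
    rw [hz] at this
    refine this.trans ?_
    have e : 2 * (3 * (A * R ^ 2)) * (R / 4) / (R / 2 - R / 4) +
        ‖g 0‖ * (R / 2 + R / 4) / (R / 2 - R / 4) = 6 * A * R ^ 2 + 3 * ‖g 0‖ := by
      rw [show R / 2 - R / 4 = R / 4 by ring]
      field_simp
      ring
    rw [e]
    nlinarith [norm_nonneg (g 0), one_le_pow₀ hR (n := 2)]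
  have hder : ∀ n : ℕ, 3 ≤ n → iteratedDeriv n g 0 = 0 := by
    intro n hn
    set B := 6 * A + 3 * ‖g 0‖
    have hB : 0 < B := by positivity
    -- Cauchy's estimate gives `n! B R² (4 / R)^n`, and `R² / R^n ≤ 1 / R` since `n ≥ 3`.
    have hle : ∀ R : ℝ, 1 ≤ R → ‖iteratedDeriv n g 0‖ ≤ n.factorial * B * 4 ^ n / R := by
      intro R hR
      have hR0 : 0 < R := one_pos.trans_le hR
      refine (Complex.norm_iteratedDeriv_le_of_forall_mem_sphere_norm_le n (by positivity)
        hg.diffContOnCl (hnorm R hR)).trans ?_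
      rw [div_pow, div_div_eq_mul_div, div_le_div_iff₀ (by positivity) hR0]
      have : R ^ 3 ≤ R ^ n := pow_le_pow_right₀ hR hn
      calc (n.factorial : ℝ) * (B * R ^ 2) * 4 ^ n * R = n.factorial * B * 4 ^ n * R ^ 3 := by ring
        _ ≤ _ := by gcongr
    have hlim : Filter.Tendsto (fun R : ℝ => n.factorial * B * 4 ^ n / R) Filter.atTop (nhds 0) :=
      Filter.Tendsto.div_atTop tendsto_const_nhds Filter.tendsto_id
    have := ge_of_tendsto hlim ((Filter.eventually_ge_atTop 1).mono hle)
    exact norm_le_zero_iff.1 this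
  refine ⟨2⁻¹ * iteratedDeriv 2 g 0, iteratedDeriv 1 g 0, iteratedDeriv 0 g 0, fun z => ?_⟩
  have h1 := Complex.hasSum_taylorSeries_of_entire hg 0 z
  have h2 : HasSum (fun n : ℕ => (n.factorial : ℂ)⁻¹ • (z - 0) ^ n • iteratedDeriv n g 0)
      (∑ n ∈ Finset.range 3, (n.factorial : ℂ)⁻¹ • (z - 0) ^ n • iteratedDeriv n g 0) :=
    hasSum_sum_of_ne_finset_zero fun n hn => by
      rw [Finset.mem_range, not_lt] at hn
      simp [hder n hn]
  rw [h1.unique h2]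
  simp [Finset.sum_range_succ]
  ring

/-! ### Elimination of the quadratic terms. -/

section Quadratic

variable {ι : Type*} [Fintype ι]

theorem sum_sum_mul_sub_sq (E x : ι → ℝ) :
    ∑ k, ∑ l, E k * E l * (x k - x l) ^ 2 =
      2 * ((∑ k, E k) * ∑ k, E k * x k ^ 2 - (∑ k, E k * x k) ^ 2) := by
  have h : ∀ k l, E k * E l * (x k - x l) ^ 2 =
      E k * x k ^ 2 * E l + E k * (E l * x l ^ 2) - 2 * (E k * x k * (E l * x l)) :=
    fun k l => by ring
  simp only [h, Finset.sum_sub_distrib, Finset.sum_add_distrib, ← Finset.mul_sum,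
    ← Finset.sum_mul]
  ring

/-- By Lagrange's identity the right side is the sum of `E k * E l * ‖a k - a l‖ ^ 2` over all
pairs. These terms are nonnegative, so a single one bounds it from below. -/
theorem mul_norm_sub_sq_le {E : ι → ℝ} (hE : ∀ k, 0 ≤ E k) (a : ι → ℂ) (i j : ι) :
    E i * E j * ‖a i - a j‖ ^ 2 ≤
      2 * ((∑ k, E k) * ∑ k, E k * ‖a k‖ ^ 2 - ‖∑ k, (E k : ℂ) * a k‖ ^ 2) := by
  have h1 : ∑ k, ∑ l, E k * E l * ‖a k - a l‖ ^ 2 =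
      2 * ((∑ k, E k) * ∑ k, E k * ‖a k‖ ^ 2 - ‖∑ k, (E k : ℂ) * a k‖ ^ 2) := by
    simp only [← Complex.normSq_eq_norm_sq, Complex.normSq_apply, Complex.re_sum, Complex.im_sum,
      Complex.re_ofReal_mul, Complex.im_ofReal_mul, ← sq, Complex.sub_re, Complex.sub_im, mul_add,
      Finset.sum_add_distrib, sum_sum_mul_sub_sq]
    ring
  rw [← h1]
  have h0 : ∀ k l, 0 ≤ E k * E l * ‖a k - a l‖ ^ 2 := fun k l =>
    mul_nonneg (mul_nonneg (hE k) (hE l)) (sq_nonneg _)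
  exact (Finset.single_le_sum (f := fun l => E i * E l * ‖a i - a l‖ ^ 2) (fun l _ => h0 i l)
    (Finset.mem_univ j)).trans (Finset.single_le_sum
      (f := fun k => ∑ l, E k * E l * ‖a k - a l‖ ^ 2)
      (fun k _ => Finset.sum_nonneg fun l _ => h0 k l) (Finset.mem_univ i))

/-- Where two of the functions `|e^{g_k}|` are simultaneously maximal, the Fubini–Study density
bounds the difference of the corresponding logarithmic derivatives. -/
theorem norm_deriv_sub_sq_le_fsDensity {g : ι → ℂ → ℂ} {z : ℂ} {i j : ι}
    (hi : ∀ k, (g k z).re ≤ (g i z).re) (hj : ∀ k, (g k z).re ≤ (g j z).re) :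
    ‖deriv (g i) z - deriv (g j) z‖ ^ 2 ≤ 2 * (Fintype.card ι : ℝ) ^ 2 * fsDensity g z := by
  have : Nonempty ι := ⟨i⟩
  have hS := expSum_pos g z
  have hij : (g j z).re = (g i z).re := le_antisymm (hi j) (hj i)
  -- Maximality lets the two equal weights at `i` and `j` absorb the denominator of the density, at
  -- the cost of `card²`.
  have hSle : expSum g z ≤ Fintype.card ι * Real.exp (2 * (g i z).re) := by
    refine (Finset.sum_le_card_nsmul _ _ (Real.exp (2 * (g i z).re)) fun k _ => ?_).trans_eq ?_
    · have := hi k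
      gcongr
    · simp
  have hmain := mul_norm_sub_sq_le (fun k => (Real.exp_pos (2 * (g k z).re)).le)
    (fun k => deriv (g k) z) i j
  rw [hij] at hmain
  have hD : fsDensity g z * expSum g z ^ 2 = _ := div_mul_cancel₀ _ (pow_pos hS 2).ne'
  rw [← expSum, ← hD] at hmain
  have h2 : expSum g z ^ 2 ≤ (Fintype.card ι * Real.exp (2 * (g i z).re)) ^ 2 := by gcongr
  refine le_of_mul_le_mul_right ?_ (pow_pos hS 2)
  calc ‖deriv (g i) z - deriv (g j) z‖ ^ 2 * expSum g z ^ 2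
      ≤ ‖deriv (g i) z - deriv (g j) z‖ ^ 2 *
        (Fintype.card ι * Real.exp (2 * (g i z).re)) ^ 2 := by gcongr
    _ = (Fintype.card ι : ℝ) ^ 2 * (Real.exp (2 * (g i z).re) * Real.exp (2 * (g i z).re) *
        ‖deriv (g i) z - deriv (g j) z‖ ^ 2) := by ring
    _ ≤ (Fintype.card ι : ℝ) ^ 2 * (2 * (fsDensity g z * expSum g z ^ 2)) := by gcongr
    _ = _ := by ring

theorem eventually_re_quadratic_pos {c v : ℂ} (h : 0 < (c * v ^ 2).re) (b a : ℂ) :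
    ∀ᶠ R : ℝ in Filter.atTop, 0 < (c * (R * v) ^ 2 + b * (R * v) + a).re := by
  have hlim : Filter.Tendsto (fun R : ℝ => R * ((c * v ^ 2).re * R + (b * v).re) + a.re)
      Filter.atTop Filter.atTop :=
    Filter.tendsto_atTop_add_const_right _ _ (Filter.tendsto_id.atTop_mul_atTop₀
      (Filter.tendsto_atTop_add_const_right _ _ (Filter.tendsto_id.const_mul_atTop h)))
  filter_upwards [hlim.eventually_gt_atTop 0] with R hR
  refine hR.trans_eq ?_
  rw [show c * (R * v) ^ 2 + b * (R * v) + a = ((R ^ 2 : ℝ) : ℂ) * (c * v ^ 2) + R * (b * v) + a by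
    push_cast; ring]
  simp only [Complex.add_re, Complex.re_ofReal_mul]
  ring

theorem eventually_lt_norm_linear_sq {c : ℂ} (hc : c ≠ 0) (b : ℂ) (L : ℝ) :
    ∀ᶠ R : ℝ in Filter.atTop, ∀ z : ℂ, ‖z‖ = R → L < ‖c * z + b‖ ^ 2 := by
  have hlim : Filter.Tendsto (fun R : ℝ => ‖c‖ * R - ‖b‖) Filter.atTop Filter.atTop :=
    Filter.tendsto_atTop_add_const_right _ _
      (Filter.tendsto_id.const_mul_atTop (norm_pos_iff.2 hc))
  filter_upwards [hlim.eventually_gt_atTop (max L 1)] with R hR z hz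
  have h1 : ‖c‖ * R - ‖b‖ ≤ ‖c * z + b‖ := by
    rw [← hz, ← norm_mul]
    simpa using norm_sub_norm_le (c * z) (-b)
  have h2 := le_max_left L 1
  have h3 := le_max_right L 1
  nlinarith

theorem exists_exp_mul_sq_eq (c : ℂ) :
    ∃ s : ℝ, c * Complex.exp (s * Complex.I) ^ 2 = ‖c‖ := by
  -- Squaring doubles the angle, so half of `-arg c` rotates `c` onto the positive axis.
  refine ⟨-c.arg / 2, ?_⟩
  nth_rw 1 [← Complex.norm_mul_exp_arg_mul_I c]
  rw [← Complex.exp_nat_mul, mul_assoc, ← Complex.exp_add]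
  have : (c.arg : ℂ) * Complex.I + (2 : ℕ) * (((-c.arg / 2 : ℝ) : ℂ) * Complex.I) = 0 := by
    push_cast; ring
  rw [this, Complex.exp_zero, mul_one]

/-- Quadratic exponents with bounded Fubini–Study density, one of which has no quadratic term, have
no quadratic terms at all. -/
theorem quadratic_coeff_eq_zero {g : ι → ℂ → ℂ} {c b a : ι → ℂ}
    (hg : ∀ k z, g k z = c k * z ^ 2 + b k * z + a k) {K : ℝ} (hK : ∀ z, fsDensity g z ≤ K)
    {o : ι} (ho : c o = 0) (k : ι) : c k = 0 := by
  have : Nonempty ι := ⟨o⟩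
  obtain ⟨j, hj⟩ := Finite.exists_max fun k => ‖c k‖
  by_contra hk
  have hcj : 0 < ‖c j‖ := (norm_pos_iff.2 hk).trans_le (hj k)
  have hder : ∀ i z, deriv (g i) z = 2 * c i * z + b i := by
    intro i z
    rw [show g i = fun z => c i * z ^ 2 + b i * z + a i from funext (hg i)]
    have : HasDerivAt (fun z => c i * z ^ 2 + b i * z + a i) (c i * (2 * z) + b i) z := by
      simpa using! (((hasDerivAt_pow 2 z).const_mul (c i)).add
        ((hasDerivAt_id z).const_mul (b i))).add_const (a i)
    rw [this.deriv]
    ring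
  have hgc : ∀ i, Continuous (g i) := fun i => by
    rw [show g i = fun z => c i * z ^ 2 + b i * z + a i from funext (hg i)]
    fun_prop
  -- In direction `s₁` the term `c j * z ^ 2` is positive, so only exponents with leading
  -- coefficient `c j` can be maximal far out. In direction `s₀` it is negative, so these all lose
  -- to `g o`.
  obtain ⟨s₁, hs₁⟩ := exists_exp_mul_sq_eq (c j)
  obtain ⟨s₀, hs₀⟩ := exists_exp_mul_sq_eq (-c j)
  have hev₁ : ∀ᶠ R : ℝ in Filter.atTop, ∀ i, c i ≠ c j →
      (g i (R * Complex.exp (s₁ * Complex.I))).re < (g j (R * Complex.exp (s₁ * Complex.I))).re := by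
    refine Filter.eventually_all.2 fun i => ?_
    by_cases hi : c i = c j
    · exact Filter.Eventually.of_forall fun _ h => absurd hi h
    have hpos : 0 < ((c j - c i) * Complex.exp (s₁ * Complex.I) ^ 2).re := by
      set v := Complex.exp (s₁ * Complex.I) ^ 2 with hv
      have hv1 : ‖v‖ = 1 := by rw [hv, norm_pow, Complex.norm_exp_ofReal_mul_I, one_pow]
      have hn : ‖c i * v‖ ≤ ‖c j‖ := by rw [norm_mul, hv1, mul_one]; exact hj i
      rw [sub_mul, hs₁, Complex.sub_re, Complex.ofReal_re, sub_pos]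
      -- Equality would make `c i * v` a nonnegative real of modulus `‖c j‖`, hence equal to `c j *
      -- v`.
      refine lt_of_le_of_ne ((Complex.re_le_norm _).trans hn) fun h => hi ?_
      have hre : (c i * v).re = ‖c i * v‖ :=
        le_antisymm (Complex.re_le_norm _) (hn.trans h.ge)
      have hnn := Complex.re_eq_norm.1 hre
      have : c i * v = c j * v := by
        rw [hs₁, ← h]
        exact Complex.ext rfl (by simpa using (Complex.nonneg_iff.1 hnn).2.symm)
      exact mul_right_cancel₀ (norm_ne_zero_iff.1 (by rw [hv1]; exact one_ne_zero)) this
    filter_upwards [eventually_re_quadratic_pos hpos (b j - b i) (a j - a i)] with R hR _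
    rw [← sub_pos, ← Complex.sub_re, hg, hg]
    convert hR using 2
    ring
  have hev₀ : ∀ᶠ R : ℝ in Filter.atTop, ∀ i, c i = c j →
      (g i (R * Complex.exp (s₀ * Complex.I))).re < (g o (R * Complex.exp (s₀ * Complex.I))).re := by
    refine Filter.eventually_all.2 fun i => ?_
    have hpos : 0 < ((-c j) * Complex.exp (s₀ * Complex.I) ^ 2).re := by
      rw [hs₀, Complex.ofReal_re, norm_neg]
      exact hcj
    filter_upwards [eventually_re_quadratic_pos hpos (b o - b i) (a o - a i)] with R hR hi
    rw [← sub_pos, ← Complex.sub_re, hg, hg, ho, hi]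
    convert hR using 2
    ring
  have hev₂ : ∀ᶠ R : ℝ in Filter.atTop, ∀ i l, c i ≠ c l → ∀ z : ℂ, ‖z‖ = R →
      2 * (Fintype.card ι : ℝ) ^ 2 * K < ‖deriv (g i) z - deriv (g l) z‖ ^ 2 := by
    refine Filter.eventually_all.2 fun i => Filter.eventually_all.2 fun l => ?_
    by_cases hil : c i = c l
    · exact Filter.Eventually.of_forall fun _ h => absurd hil h
    have hne : 2 * (c i - c l) ≠ 0 := mul_ne_zero two_ne_zero (sub_ne_zero.2 hil)
    filter_upwards [eventually_lt_norm_linear_sq hne (b i - b l)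
      (2 * (Fintype.card ι : ℝ) ^ 2 * K)] with R hR _ z hz
    convert hR z hz using 3
    rw [hder, hder]
    ring
  obtain ⟨R, hR₁, hR₀, hR₂, hR⟩ :=
    (hev₁.and (hev₀.and (hev₂.and (Filter.eventually_ge_atTop 0)))).exists
  let z : ℝ → ℂ := fun s => R * Complex.exp (s * Complex.I)
  have hzc : Continuous z := by fun_prop
  let T : ι → Set ℝ := fun i => {s | ∀ k, (g k (z s)).re ≤ (g i (z s)).re}
  have hT : ∀ i, IsClosed (T i) := fun i => by
    simp only [T, Set.ofPred_forall]
    exact isClosed_iInter fun k => isClosed_le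
      (Complex.continuous_re.comp ((hgc k).comp hzc)) (Complex.continuous_re.comp ((hgc i).comp hzc))
  have hTex : ∀ s, ∃ i, s ∈ T i := fun s => Finite.exists_max fun k => (g k (z s)).re
  -- The angles at which some maximal exponent has leading coefficient `c j`, and those at which
  -- some maximal exponent does not, form two closed sets covering `ℝ`. They contain `s₁` and `s₀`
  -- respectively, so they meet.
  obtain ⟨s, -, hsU, hsV⟩ := isPreconnected_closed_iff.1 (isPreconnected_univ (α := ℝ))
    (⋃ i ∈ {i | c i = c j}, T i) (⋃ i ∈ {i | c i ≠ c j}, T i)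
    (Set.Finite.isClosed_biUnion (Set.toFinite _) fun i _ => hT i)
    (Set.Finite.isClosed_biUnion (Set.toFinite _) fun i _ => hT i)
    (fun s _ => by
      obtain ⟨i, hi⟩ := hTex s
      by_cases h : c i = c j
      · exact Or.inl (Set.mem_biUnion (x := i) h hi)
      · exact Or.inr (Set.mem_biUnion (x := i) h hi))
    (by
      obtain ⟨i, hi⟩ := hTex s₁
      refine ⟨s₁, trivial, Set.mem_biUnion (x := i) ?_ hi⟩
      by_contra h
      exact (hR₁ i h).not_ge (hi j))
    (by
      obtain ⟨i, hi⟩ := hTex s₀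
      refine ⟨s₀, trivial, Set.mem_biUnion (x := i) ?_ hi⟩
      intro h
      exact (hR₀ i h).not_ge (hi o))
  obtain ⟨i, hi, hiT⟩ := Set.mem_iUnion₂.1 hsU
  obtain ⟨l, hl, hlT⟩ := Set.mem_iUnion₂.1 hsV
  have hil : c i ≠ c l := fun h => hl (h ▸ hi)
  have hz : ‖z s‖ = R := by
    simp only [z, norm_mul, Complex.norm_exp_ofReal_mul_I, mul_one, Complex.norm_real,
      Real.norm_of_nonneg hR]
  refine (hR₂ i l hil (z s) hz).not_ge ((norm_deriv_sub_sq_le_fsDensity hiT hlT).trans ?_)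
  gcongr
  exact hK _

end Quadratic

/-! ### Entire logarithms, and the manifold derivative in coordinates. -/

theorem exists_eq_exp_of_differentiable {ζ : ℂ → ℂ} (hζ : Differentiable ℂ ζ) (h0 : ∀ z, ζ z ≠ 0) :
    ∃ g : ℂ → ℂ, Differentiable ℂ g ∧ ∀ z, ζ z = Complex.exp (g z) := by
  have hlog : Differentiable ℂ fun z => deriv ζ z / ζ z := hζ.deriv.div hζ h0
  -- This value at `0` makes the constant function `ζ e^{-G}` equal to `1`.
  obtain ⟨G, hG0, hG⟩ := hlog.isExactOn_univ.with_val_at 0 (Complex.log (ζ 0))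
  have hGd : ∀ z, HasDerivAt G (deriv ζ z / ζ z) z := fun z => hG z trivial
  refine ⟨G, fun z => (hGd z).differentiableAt, fun z => ?_⟩
  have hder : ∀ z, HasDerivAt (fun z => ζ z * Complex.exp (-G z)) 0 z := fun z => by
    refine ((hζ z).hasDerivAt.fun_mul (hGd z).fun_neg.cexp).congr_deriv ?_
    field_simp [h0 z]
    ring
  have hconst := is_const_of_deriv_eq_zero (fun z => (hder z).differentiableAt)
    (fun z => (hder z).deriv) z 0
  simp only [hG0, Complex.exp_neg, Complex.exp_log (h0 0), mul_inv_cancel₀ (h0 0)] at hconst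
  exact (mul_inv_eq_one₀ (Complex.exp_ne_zero _)).1 hconst

theorem torusX.coordNe {n : ℕ} (p : torusX n) (i : Fin (n + 1)) : CPn.CoordNe i (p : CPn n) := by
  obtain ⟨p, ζ, hζ, rfl⟩ := p
  refine (CPn.coordNe_mk i _ _).2 ?_
  refine Fin.cases ?_ (fun j => ?_) i
  · simp
  · simpa using hζ j

theorem torusX.affineCoord_ne_zero {n : ℕ} (p : torusX n) (i : Fin n) :
    CPn.affineCoord 0 (p : CPn n) i ≠ 0 := by
  obtain ⟨p, ζ, hζ, rfl⟩ := p
  simpa [CPn.affinePt] using hζ i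

/-- The preferred chart is that of the first nonvanishing coordinate, which on `X` is always the
`0`-th. Hence `normDf` can be computed in one fixed chart. -/
theorem torusX.chartAt_eq {n : ℕ} (p : torusX n) :
    chartAt (EuclideanSpace ℂ (Fin n)) (p : CPn n) = CPn.affineChart 0 := by
  classical
  change CPn.affineChart (Fin.find (fun i => CPn.CoordNe i (p : CPn n)) _) = _
  congr 1
  exact le_antisymm (Fin.find_le_of_pos _ (torusX.coordNe p 0)) (Fin.zero_le _)

section

variable {n : ℕ} {f : ℂ → torusX n}

theorem torusX.mdifferentiable_coe (hf : MDifferentiable 𝓘(ℂ, ℂ) 𝓘(ℂ, EuclideanSpace ℂ (Fin n)) f) :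
    MDifferentiable 𝓘(ℂ, ℂ) 𝓘(ℂ, EuclideanSpace ℂ (Fin n)) fun z => (f z : CPn n) :=
  ((contMDiff_subtype_val (n := 1)).mdifferentiable one_ne_zero).comp hf

theorem torusX.differentiable_affineCoord
    (hf : MDifferentiable 𝓘(ℂ, ℂ) 𝓘(ℂ, EuclideanSpace ℂ (Fin n)) f) :
    Differentiable ℂ fun z => CPn.affineCoord 0 (f z : CPn n) := by
  intro z
  have : IsManifold 𝓘(ℂ, EuclideanSpace ℂ (Fin n)) 1 (CPn n) :=
    IsManifold.of_le (n := ω) le_top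
  have h1 := (mdifferentiable_of_mem_atlas (I := 𝓘(ℂ, EuclideanSpace ℂ (Fin n)))
    (e := CPn.affineChart (n := n) 0) (Set.mem_range_self 0)).mdifferentiableAt (torusX.coordNe (f z) 0)
  exact (h1.comp z (torusX.mdifferentiable_coe hf z)).differentiableAt

theorem torusX.mfderiv_coe (hf : MDifferentiable 𝓘(ℂ, ℂ) 𝓘(ℂ, EuclideanSpace ℂ (Fin n)) f)
    (z : ℂ) :
    mfderiv 𝓘(ℂ, ℂ) 𝓘(ℂ, EuclideanSpace ℂ (Fin n)) (fun w => (f w : CPn n)) z (1 : ℂ) =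
      deriv (fun z => CPn.affineCoord 0 (f z : CPn n)) z := by
  rw [(torusX.mdifferentiable_coe hf z).mfderiv]
  have : writtenInExtChartAt 𝓘(ℂ, ℂ) 𝓘(ℂ, EuclideanSpace ℂ (Fin n)) z (fun w => (f w : CPn n)) =
      fun z => CPn.affineCoord 0 (f z : CPn n) := by
    rw [writtenInExtChartAt, extChartAt, torusX.chartAt_eq]
    rfl
  rw [this, modelWithCornersSelf_coe, Set.range_id, fderivWithin_univ]
  rfl

end

/-- The zero exponent stands for the homogeneous coordinate `1`. The constant `1 / π` is the square
of `√2` times the `1 / (2π)` in the metric. -/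
theorem torusX.normDf_sq {n : ℕ} {f : ℂ → torusX n}
    (hf : MDifferentiable 𝓘(ℂ, ℂ) 𝓘(ℂ, EuclideanSpace ℂ (Fin n)) f) {g : Fin n → ℂ → ℂ}
    (hg : ∀ i, Differentiable ℂ (g i))
    (hfg : ∀ i z, CPn.affineCoord 0 (f z : CPn n) i = Complex.exp (g i z)) (z : ℂ) :
    normDf f z ^ 2 = fsDensity (Fin.cons 0 g : Fin (n + 1) → ℂ → ℂ) z / Real.pi := by
  have hder : ∀ i, deriv (fun z => CPn.affineCoord 0 (f z : CPn n)) z i =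
      Complex.exp (g i z) * deriv (g i) z := by
    intro i
    have h1 := (torusX.differentiable_affineCoord hf z).hasDerivAt
    have h2 := (EuclideanSpace.proj (𝕜 := ℂ) i).hasFDerivAt.comp_hasDerivAt z h1
    have h3 := (hg i z).hasDerivAt.cexp
    have h4 : (fun z => Complex.exp (g i z)) =
        (EuclideanSpace.proj (𝕜 := ℂ) i) ∘ fun z => CPn.affineCoord 0 (f z : CPn n) :=
      funext fun z => (hfg i z).symm
    rw [h4] at h3
    exact h2.unique h3
  have hexp : ∀ w : ℂ, ‖Complex.exp w‖ ^ 2 = Real.exp (2 * w.re) := fun w => by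
    rw [Complex.norm_exp, ← Real.exp_nat_mul, Nat.cast_ofNat]
  set ζ := CPn.affineCoord 0 (f z : CPn n) with hζ
  set w := deriv (fun z => CPn.affineCoord 0 (f z : CPn n)) z with hw
  have hchart : chartAt (EuclideanSpace ℂ (Fin n)) (f z : CPn n) (f z : CPn n) = ζ := by
    rw [torusX.chartAt_eq]
    rfl
  have hS : 1 + ‖ζ‖ ^ 2 = expSum (Fin.cons 0 g : Fin (n + 1) → ℂ → ℂ) z := by
    rw [EuclideanSpace.norm_sq_eq, expSum, Fin.sum_univ_succ]
    simp [hζ, hfg, hexp]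
  have hE : ‖w‖ ^ 2 = ∑ k, Real.exp (2 * ((Fin.cons 0 g : Fin (n + 1) → ℂ → ℂ) k z).re) *
      ‖deriv ((Fin.cons 0 g : Fin (n + 1) → ℂ → ℂ) k) z‖ ^ 2 := by
    rw [EuclideanSpace.norm_sq_eq, Fin.sum_univ_succ]
    simp [hder, mul_pow, hexp]
  have hI : inner ℂ ζ w = ∑ k,
      (Real.exp (2 * ((Fin.cons 0 g : Fin (n + 1) → ℂ → ℂ) k z).re) : ℂ) *
      deriv ((Fin.cons 0 g : Fin (n + 1) → ℂ → ℂ) k) z := by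
    rw [PiLp.inner_apply, Fin.sum_univ_succ]
    simp only [Fin.cons_zero, Fin.cons_succ, deriv_zero, Pi.zero_apply, mul_zero, zero_add]
    refine Finset.sum_congr rfl fun i _ => ?_
    rw [hder, hζ, hfg, ← hexp, ← Complex.normSq_eq_norm_sq, Complex.normSq_eq_conj_mul_self,
      RCLike.inner_apply]
    ring
  have hfs : CPn.fubiniStudyNorm (f z : CPn n)
      (mfderiv 𝓘(ℂ, ℂ) 𝓘(ℂ, EuclideanSpace ℂ (Fin n)) (fun w => (f w : CPn n)) z (1 : ℂ)) =
      Real.sqrt (((1 + ‖ζ‖ ^ 2) * ‖w‖ ^ 2 - ‖inner ℂ ζ w‖ ^ 2) /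
        (2 * Real.pi * (1 + ‖ζ‖ ^ 2) ^ 2)) := by
    rw [torusX.mfderiv_coe hf]
    simp only [CPn.fubiniStudyNorm, hchart]
    rfl
  have hCS : ‖inner ℂ ζ w‖ ^ 2 ≤ (1 + ‖ζ‖ ^ 2) * ‖w‖ ^ 2 := by
    have h1 := norm_inner_le_norm (𝕜 := ℂ) ζ w
    have h2 : ‖inner ℂ ζ w‖ ^ 2 ≤ (‖ζ‖ * ‖w‖) ^ 2 := by gcongr
    nlinarith [sq_nonneg ‖w‖]
  rw [normDf, hfs, mul_pow, Real.sq_sqrt zero_le_two, Real.sq_sqrt (div_nonneg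
    (sub_nonneg.2 hCS) (by positivity)), hS, hE, hI, fsDensity]
  field_simp

theorem mainTheorem5 (n : ℕ) (f : ℂ → torusX n)
    (hf : MDifferentiable 𝓘(ℂ, ℂ) 𝓘(ℂ, EuclideanSpace ℂ (Fin n)) f)
    (C : ℝ) (hC : 0 < C) (hbound : ∀ z : ℂ, normDf f z ≤ C) :
    ∃ a b : Fin n → ℂ, ∀ z : ℂ,
      (f z : CPn n) = CPn.affinePt 0 (fun i => Complex.exp (a i * z + b i)) := by
  have hlog : ∀ i : Fin n, ∃ g : ℂ → ℂ, Differentiable ℂ g ∧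
      ∀ z, CPn.affineCoord 0 (f z : CPn n) i = Complex.exp (g z) := fun i =>
    exists_eq_exp_of_differentiable
      ((EuclideanSpace.proj (𝕜 := ℂ) i).differentiable.comp (torusX.differentiable_affineCoord hf))
      fun z => torusX.affineCoord_ne_zero (f z) i
  choose g hg hfg using hlog
  set G : Fin (n + 1) → ℂ → ℂ := Fin.cons 0 g with hG
  have hGd : ∀ k, Differentiable ℂ (G k) :=
    Fin.cases (differentiable_const (0 : ℂ)) fun i => hg i
  have hK : ∀ z, fsDensity G z ≤ C ^ 2 * Real.pi := fun z => by
    rw [← div_le_iff₀ Real.pi_pos, ← torusX.normDf_sq hf hg hfg]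
    have h0 : 0 ≤ normDf f z := mul_nonneg (Real.sqrt_nonneg _) (Real.sqrt_nonneg _)
    gcongr
    exact hbound z
  obtain ⟨A, hA, havg⟩ := circleAverage_fsPotential_le hGd hK
  -- The zero exponent alone contributes `1` to the sum inside the logarithm.
  have hφ0 : ∀ z, 0 ≤ fsPotential G z := fun z => by
    simpa [hG] using re_le_fsPotential G 0 z
  choose c b a hquad using fun k => (hGd k).eq_quadratic_of_circleAverage_le
    (continuous_fsPotential fun k => (hGd k).continuous) hφ0 (re_le_fsPotential G k) hA havg
  have hc0 : c 0 = 0 := by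
    have h0 : ∀ z, c 0 * z ^ 2 + b 0 * z + a 0 = 0 := fun z => by
      rw [← hquad, hG]
      rfl
    -- The second difference at `-1, 0, 1` isolates `2 * c 0`.
    have h1 := h0 0
    have h2 := h0 1
    have h3 := h0 (-1)
    linear_combination (h2 + h3 - 2 * h1) / 2
  refine ⟨fun i => b i.succ, fun i => a i.succ, fun z => ?_⟩
  rw [← CPn.affinePt_affineCoord 0 (f z : CPn n) (torusX.coordNe (f z) 0)]
  congr 1
  funext i
  have h := hquad i.succ z
  rw [quadratic_coeff_eq_zero hquad hK hc0, zero_mul, zero_add] at h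
  rw [hfg, ← h, hG, Fin.cons_succ]
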